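/- A CP contraction between C*-algebras (with or without unit) is a completely positive linear map of operator norm at most $1$. A linear map $\alpha: S\to T$ between linear subspaces $S\subseteq A$, $T\subseteq B$ of C*-algebras is completely isometric if, for every $n$, the map $(x_{ij})\mapsto(\alpha(x_{ij}))$ preserves norms of $n\times n$ matrices with entries in $S$, the norms being those of the C*-algebras $M_n(A)$ and $M_n(B)$. Proposition 3.2. For every CP contraction $P: A\to A$ on a C*-algebra $A$, the following are equivalent. (i) $P$ admits a factorization $P=\alpha\circ E$, where $E: A\to A$ is an idempotent CP contraction and $\alpha$ is a completely isometric linear map of $E(A)$ onto itself. (ii) There are a C*-algebra $B$, a $*$-automorphism $\beta$ of $B$, and CP contractions $\theta: A\to B$ and $\theta_*: B\to A$ such that $\theta\circ\theta_*=\mathrm{id}_B$ and $P=\theta_*\circ\beta\circ\theta$. If $A$ has a unit $\mathbf 1$ and $P(\mathbf 1)=\mathbf 1$, then (i) can be replaced with (i)$'$ the restriction of $P$ to $P(A)$ is a completely isometric map of $P(A)$ onto itself; that is, in this case (i)$'$ is equivalent to (ii), and hence also to (i). -/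

import Mathlib

open scoped CStarAlgebra

section CPDefs

universe u v

/-- A linear map `f : S → T` between linear subspaces of C⋆-algebras `A` and `B` is completely
isometric: for every `n`, applying `f` to the entries of an `n × n` matrix with entries in `S`
preserves its norm, where matrices over `A` and over `B` carry their C⋆-norms. -/
def IsCompletelyIsometric {A : Type u} {B : Type v}
    [NonUnitalCStarAlgebra A] [PartialOrder A] [StarOrderedRing A]
    [NonUnitalCStarAlgebra B] [PartialOrder B] [StarOrderedRing B]
    {S : Submodule ℂ A} {T : Submodule ℂ B} (f : S →ₗ[ℂ] T) : Prop :=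
  ∀ (n : ℕ) (x : Fin n → Fin n → S),
    ‖(CStarMatrix.ofMatrix fun i j => (f (x i j) : B) : CStarMatrix (Fin n) (Fin n) B)‖ =
      ‖(CStarMatrix.ofMatrix fun i j => (x i j : A) : CStarMatrix (Fin n) (Fin n) A)‖

/-- A completely positive map of operator norm at most one. -/
def CompletelyPositiveMap.IsContraction {A : Type u} {B : Type v}
    [NonUnitalCStarAlgebra A] [PartialOrder A] [StarOrderedRing A]
    [NonUnitalCStarAlgebra B] [PartialOrder B] [StarOrderedRing B] (P : A →CP B) : Prop :=
  ∀ a : A, ‖P a‖ ≤ ‖a‖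

/-- The range of a completely positive map, as a linear subspace. -/
def CompletelyPositiveMap.range {A : Type u} {B : Type v}
    [NonUnitalCStarAlgebra A] [PartialOrder A] [StarOrderedRing A]
    [NonUnitalCStarAlgebra B] [PartialOrder B] [StarOrderedRing B] (P : A →CP B) :
    Submodule ℂ B :=
  LinearMap.range P.toLinearMap

/-- `P = α ∘ E` with `E : A → A` an idempotent completely positive contraction and `α` a
completely isometric linear map of `E(A)` onto itself. -/
def HasPolarFactorization {A : Type u}
    [NonUnitalCStarAlgebra A] [PartialOrder A] [StarOrderedRing A] (P : A →CP A) : Prop :=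
  ∃ (E : A →CP A) (α : E.range →ₗ[ℂ] E.range),
    E.IsContraction ∧ (∀ a : A, E (E a) = E a) ∧
    IsCompletelyIsometric α ∧ Function.Surjective α ∧
    ∀ a : A, P a = α ⟨E a, LinearMap.mem_range_self E.toLinearMap a⟩

/-- There are a C⋆-dynamical system `(B, β)` and completely positive contractions `θ : A → B`,
`θ' : B → A` with `θ ∘ θ' = id` and `P = θ' ∘ β ∘ θ`. Since such a `B` is a surjective image of
`A`, nothing is lost by taking it in the universe of `A`. -/
def ArisesFromDynamicalSystem {A : Type u}
    [NonUnitalCStarAlgebra A] [PartialOrder A] [StarOrderedRing A] (P : A →CP A) : Prop :=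
  ∃ (B : Type u) (_ : NonUnitalCStarAlgebra B) (_ : PartialOrder B) (_ : StarOrderedRing B)
    (β : B ≃⋆ₐ[ℂ] B) (θ : A →CP B) (θ' : B →CP A),
    θ.IsContraction ∧ θ'.IsContraction ∧ (∀ b : B, θ (θ' b) = b) ∧
    ∀ a : A, P a = θ' (β (θ a))

/-- The restriction of `P : A → A` to its range, as a linear map `P(A) → P(A)`. -/
def CompletelyPositiveMap.restrictRange {A : Type u}
    [NonUnitalCStarAlgebra A] [PartialOrder A] [StarOrderedRing A] (P : A →CP A) :
    P.range →ₗ[ℂ] P.range :=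
  P.toLinearMap.rangeRestrict ∘ₗ P.range.subtype

end CPDefs

/-!
A completely positive contraction satisfies the Schwarz inequality, and so do its matrix
amplifications. Where the inequality is an equality the map is multiplicative (Choi); this has two
consequences. The range of an idempotent CP contraction `E` is a C⋆-algebra for the Choi–Effros
product `E (x * y)`, and the inclusion and the corestriction of `E` are CP contractions. Mutually
inverse CP contractions are ⋆-isomorphisms.

Given `P = α ∘ E`, the map `α` acts on the Choi–Effros algebra of `E`. A positive isometry between
C⋆-algebras reflects positivity, so `α` and its inverse are CP contractions and `α` is a
⋆-automorphism. Conversely, `θ' ∘ θ` is an idempotent CP contraction and `θ' ∘ β⁻¹ ∘ θ` inverts `P`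
on its range. For unital `P`, the projection is `(P|_{P(A)})⁻¹ ∘ P`. It is completely positive
because a selfadjoint `x` with `‖x‖ ≤ r` is positive exactly when `‖r - x‖ ≤ r`, so that unital
complete isometries reflect positivity.
-/

open Filter Topology

section OrderEmbedding

variable {A B : Type*} [NonUnitalCStarAlgebra A] [PartialOrder A] [StarOrderedRing A]
  [NonUnitalCStarAlgebra B] [PartialOrder B] [StarOrderedRing B]

theorem eq_zero_of_map_le_map_of_mul_eq_zero (f : A →ₚ[ℂ] B) (hf : ∀ a, ‖f a‖ = ‖a‖) {p q : A}
    (hp : 0 ≤ p) (hq : 0 ≤ q) (hpq : p * q = 0) (hle : f q ≤ f p) : q = 0 := by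
  by_contra hq0
  have hnq : 0 < ‖q‖ := norm_pos_iff.2 hq0
  set t : ℝ := ‖p‖ / ‖q‖
  have htq : t * ‖q‖ = ‖p‖ := div_mul_cancel₀ _ hnq.ne'
  have ht0 : 0 ≤ t := by positivity
  have hmax : ‖p + t • q‖ = ‖p‖ := by
    rw [IsSelfAdjoint.norm_add_eq_max (.of_nonneg hp) (.smul (.all t) (.of_nonneg hq))
      (by rw [mul_smul_comm, hpq, smul_zero]), norm_smul, Real.norm_of_nonneg ht0, htq, max_self]
  have hge : (1 + t) • f q ≤ f (p + t • q) := by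
    rw [map_add, add_smul, one_smul, f.map_smul_of_tower]
    gcongr
  have hnorm := CStarAlgebra.norm_le_norm_of_nonneg_of_le
    (smul_nonneg (by positivity) (f.map_nonneg hq)) hge
  rw [hf, hmax, norm_smul, hf, Real.norm_of_nonneg (by positivity), add_mul, one_mul, htq] at hnorm
  linarith

theorem nonneg_of_map_nonneg_of_norm_map (f : A →ₚ[ℂ] B) (hf : ∀ a, ‖f a‖ = ‖a‖) {a : A}
    (h : 0 ≤ f a) : 0 ≤ a := by
  have ha : IsSelfAdjoint a :=
    (AddMonoidHomClass.isometry_of_norm f hf).injective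
      (by rw [map_star, (IsSelfAdjoint.of_nonneg h).star_eq])
  have hle : f a⁻ ≤ f a⁺ := by
    rwa [← sub_nonneg, ← map_sub, CFC.posPart_sub_negPart a ha]
  exact (CFC.negPart_eq_zero_iff a ha).1 <|
    eq_zero_of_map_le_map_of_mul_eq_zero f hf (CFC.posPart_nonneg a) (CFC.negPart_nonneg a)
      (CFC.posPart_mul_negPart a) hle

end OrderEmbedding

theorem nonneg_iff_norm_smul_one_sub_le {A : Type*} [CStarAlgebra A] [PartialOrder A]
    [StarOrderedRing A] {a : A} (ha : IsSelfAdjoint a) {r : ℝ} (hr : ‖a‖ ≤ r) :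
    0 ≤ a ↔ ‖(r : ℂ) • (1 : A) - a‖ ≤ r := by
  lift r to NNReal using (norm_nonneg a).trans hr
  rw [nonneg_iff_isSelfAdjoint_and_quasispectrumRestricts, and_iff_right ha, Complex.coe_smul,
    ← Algebra.algebraMap_eq_smul_one]
  exact SpectrumRestricts.nnreal_iff_nnnorm ha hr

/-- `CStarAlgebra.nonneg_iff_eq_star_mul_self` cannot be applied to `CStarMatrix` directly, where
unification does not find its implicit functional calculus instances. -/
theorem exists_star_mul_self_eq {A : Type*} [NonUnitalCStarAlgebra A] [PartialOrder A]
    [StarOrderedRing A] {a : A} (ha : 0 ≤ a) : ∃ b, star b * b = a :=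
  (CStarAlgebra.nonneg_iff_eq_star_mul_self.1 ha).imp fun _ => Eq.symm

section Matrices

open scoped WithCStarModule

variable {A : Type*} [NonUnitalCStarAlgebra A] {m n : Type*} [Fintype m] [Fintype n]

/-- Cauchy–Schwarz in the Hilbert module `Aⁿ`: a positive matrix is a Gram matrix of columns. -/
theorem star_apply_mul_apply_le_norm_smul [PartialOrder A] [StarOrderedRing A]
    {M : CStarMatrix n n A} (hM : 0 ≤ M) (i j : n) :
    star (M i j) * M i j ≤ ‖M i i‖ • M j j := by
  obtain ⟨N, rfl⟩ := exists_star_mul_self_eq hM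
  let row (k : n) : C⋆ᵐᵒᵈ(A, n → A) :=
    (WithCStarModule.equiv A (n → A)).symm fun l => star (N l k)
  have hinner (k l : n) : (star N * N) k l = inner A (row l) (row k) := by
    simp only [CStarMatrix.mul_apply, CStarMatrix.star_apply, WithCStarModule.pi_inner,
      WithCStarModule.inner_def, row, WithCStarModule.equiv_symm_pi_apply, star_star]
  rw [hinner, hinner, hinner, CStarModule.star_inner, ← CStarModule.norm_sq_eq]
  exact CStarModule.inner_mul_inner_swap_le

/-- The `2 × 2` matrix with first row `(a, b)` and second row zero. -/
def rowMatrix (a b : A) : CStarMatrix (Fin 2) (Fin 2) A := .ofMatrix !![a, b; 0, 0]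

theorem star_rowMatrix_mul_rowMatrix (a b c d : A) :
    star (rowMatrix a b) * rowMatrix c d =
      .ofMatrix !![star a * c, star a * d; star b * c, star b * d] := by
  ext i j
  fin_cases i <;> fin_cases j <;> simp [rowMatrix, CStarMatrix.mul_apply, CStarMatrix.star_apply]

variable (m n A) in
/-- The identification of `M_m(M_n(A))` with `M_{m × n}(A)`. -/
def blockEquiv : CStarMatrix m m (CStarMatrix n n A) ≃⋆ₐ[ℂ] CStarMatrix (m × n) (m × n) A where
  toFun M := .ofMatrix fun p q => M p.1 q.1 p.2 q.2
  invFun N := .ofMatrix fun i j => .ofMatrix fun k l => N (i, k) (j, l)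
  left_inv _ := rfl
  right_inv _ := rfl
  map_mul' M N := by
    ext p q
    simp only [CStarMatrix.mul_apply, Fintype.sum_prod_type]
    exact Matrix.sum_apply p.2 q.2 Finset.univ fun j => M p.1 j * N j q.1
  map_add' _ _ := rfl
  map_star' _ := rfl
  map_smul' _ _ := rfl

variable (n) in
/-- The amplification `a ↦ diag(a, …, a)` of `A` into its matrices. -/
def scalarHom [DecidableEq n] : A →⋆ₙₐ[ℂ] CStarMatrix n n A where
  toFun a := .ofMatrix (Matrix.diagonal fun _ => a)
  map_smul' c a := by ext i j; by_cases h : i = j <;> simp [h]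
  map_zero' := Matrix.diagonal_zero
  map_add' a b := (Matrix.diagonal_add _ _).symm
  map_mul' a b := (Matrix.diagonal_mul_diagonal _ _).symm
  map_star' a := (Matrix.diagonal_conjTranspose _).symm

theorem scalarHom_apply [DecidableEq n] (a : A) (i j : n) :
    scalarHom n a i j = if i = j then a else 0 :=
  Matrix.diagonal_apply _ i j

theorem norm_scalarHom [PartialOrder A] [StarOrderedRing A] [DecidableEq n] [Nonempty n] (a : A) :
    ‖scalarHom n a‖ = ‖a‖ := by
  obtain ⟨i⟩ := ‹Nonempty n›
  refine NonUnitalStarAlgHom.norm_map (scalarHom n) (fun a b hab => ?_) a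
  simpa only [scalarHom_apply, if_true] using CStarMatrix.ext_iff.2 hab i i

end Matrices

namespace CPMap

section Schwarz

variable {A B C : Type*} [NonUnitalCStarAlgebra A] [PartialOrder A] [StarOrderedRing A]
  [NonUnitalCStarAlgebra B] [PartialOrder B] [StarOrderedRing B]
  [NonUnitalCStarAlgebra C] [PartialOrder C] [StarOrderedRing C]

/-- The composition of completely positive maps. -/
def comp (ψ : B →CP C) (φ : A →CP B) : A →CP C where
  toLinearMap := ψ.toLinearMap ∘ₗ φ.toLinearMap
  map_cstarMatrix_nonneg' _ M hM := ψ.map_cstarMatrix_nonneg _ (φ.map_cstarMatrix_nonneg M hM)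

theorem isContraction_comp {ψ : B →CP C} {φ : A →CP B} (hψ : ψ.IsContraction)
    (hφ : φ.IsContraction) : (comp ψ φ).IsContraction :=
  fun a => (hψ _).trans (hφ a)

/-- The entrywise action of a completely positive map on square matrices, again completely
positive because matrices of matrices are matrices. -/
def mapMatrix (n : Type*) [Fintype n] (φ : A →CP B) : CStarMatrix n n A →CP CStarMatrix n n B where
  toLinearMap := CStarMatrix.mapₗ φ.toLinearMap
  map_cstarMatrix_nonneg' k M hM := by
    have hblock := φ.map_cstarMatrix_nonneg _ (map_nonneg (blockEquiv A (Fin k) n) hM)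
    have hunblock : 0 ≤ (blockEquiv B (Fin k) n).symm ((blockEquiv A (Fin k) n M).map φ) :=
      map_nonneg (blockEquiv B (Fin k) n).symm hblock
    refine hunblock.trans_eq ?_
    ext i j
    rfl

theorem mapMatrix_apply {n : Type*} [Fintype n] (φ : A →CP B) (M : CStarMatrix n n A) :
    mapMatrix n φ M = M.map φ := rfl

theorem mapMatrix_scalarHom {n : Type*} [Fintype n] [DecidableEq n] (φ : A →CP B) (a : A) :
    mapMatrix n φ (scalarHom n a) = scalarHom n (φ a) := by
  ext i j
  rw [mapMatrix_apply, CStarMatrix.map_apply, scalarHom_apply, scalarHom_apply, apply_ite φ,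
    map_zero]

theorem star_map_mul_map_le_norm_smul (φ : A →CP B) (a b : A) :
    star (φ (star a * b)) * φ (star a * b) ≤ ‖φ (star a * a)‖ • φ (star b * b) := by
  have h := φ.map_cstarMatrix_nonneg _ (star_mul_self_nonneg (rowMatrix a b))
  rw [star_rowMatrix_mul_rowMatrix] at h
  simpa using star_apply_mul_apply_le_norm_smul h 0 1

/-- The elements `u i` stand in for the unit that the usual proof inserts. -/
theorem star_map_mul_map_le_of_tendsto (φ : A →CP B) {ι : Type*} {l : Filter ι} [l.NeBot]
    {u : ι → A} {a : A} (hlim : Tendsto (fun i => star (u i) * a) l (𝓝 a))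
    (hφ : ∀ᶠ i in l, ‖φ (star (u i) * u i)‖ ≤ 1) : star (φ a) * φ a ≤ φ (star a * a) := by
  have hlim' : Tendsto (fun i => φ (star (u i) * a)) l (𝓝 (φ a)) :=
    ((map_continuous φ).tendsto a).comp hlim
  refine le_of_tendsto (hlim'.star.mul hlim') (hφ.mono fun i hi => ?_)
  calc star (φ (star (u i) * a)) * φ (star (u i) * a)
      ≤ ‖φ (star (u i) * u i)‖ • φ (star a * a) := star_map_mul_map_le_norm_smul φ (u i) a
    _ ≤ (1 : ℝ) • φ (star a * a) :=
      smul_le_smul_of_nonneg_right hi (map_nonneg φ (star_mul_self_nonneg a))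
    _ = φ (star a * a) := one_smul ℝ _

theorem schwarz {φ : A →CP B} (hφ : φ.IsContraction) (a : A) :
    star (φ a) * φ a ≤ φ (star a * a) := by
  have hu := CStarAlgebra.increasingApproximateUnit A
  refine star_map_mul_map_le_of_tendsto φ (u := id) (l := CStarAlgebra.approximateUnit A) ?_ ?_
  · refine (hu.tendsto_mul_right a).congr' ?_
    filter_upwards [hu.eventually_star_eq] with e he
    rw [id, he]
  · filter_upwards [hu.eventually_norm] with e he
    exact (hφ _).trans ((CStarRing.norm_star_mul_self).trans_le (mul_le_one₀ he (norm_nonneg _) he))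

theorem schwarz_mapMatrix {φ : A →CP B} (hφ : φ.IsContraction) {n : Type*} [Fintype n]
    (M : CStarMatrix n n A) :
    star (mapMatrix n φ M) * mapMatrix n φ M ≤ mapMatrix n φ (star M * M) := by
  classical
  have hu := CStarAlgebra.increasingApproximateUnit A
  refine star_map_mul_map_le_of_tendsto (mapMatrix n φ) (u := scalarHom n)
    (l := CStarAlgebra.approximateUnit A) ?_ ?_
  · refine tendsto_pi_nhds.2 fun i => tendsto_pi_nhds.2 fun j => ?_
    refine (hu.tendsto_mul_right (M i j)).congr' ?_
    filter_upwards [hu.eventually_star_eq] with e he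
    rw [← map_star, he, CStarMatrix.mul_apply]
    simp only [scalarHom_apply, ite_mul, zero_mul, Finset.sum_ite_eq, Finset.mem_univ, if_true]
  · filter_upwards [hu.eventually_norm] with e he
    rw [← map_star, ← map_mul, mapMatrix_scalarHom]
    exact (NonUnitalStarAlgHom.norm_apply_le _ _).trans <| (hφ _).trans <|
      (CStarRing.norm_star_mul_self).trans_le (mul_le_one₀ he (norm_nonneg _) he)

theorem isContraction_of_schwarz {φ : A →CP B} (h : ∀ a, star (φ a) * φ a ≤ φ (star a * a)) :
    φ.IsContraction := by
  let f : A →L[ℂ] B := ⟨φ.toLinearMap, map_continuous φ⟩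
  have hsq (a : A) : ‖f a‖ ^ 2 ≤ ‖f‖ * ‖a‖ ^ 2 := by
    rw [sq, sq, ← CStarRing.norm_star_mul_self, ← CStarRing.norm_star_mul_self]
    exact (CStarAlgebra.norm_le_norm_of_nonneg_of_le (star_mul_self_nonneg _) (h a)).trans
      (f.le_opNorm _)
  have hroot : ‖f‖ ≤ √‖f‖ := f.opNorm_le_bound (Real.sqrt_nonneg _) fun a =>
    (Real.le_sqrt_of_sq_le (hsq a)).trans_eq
      (by rw [Real.sqrt_mul (norm_nonneg f), Real.sqrt_sq (norm_nonneg a)])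
  have hf : ‖f‖ ≤ 1 := Real.le_sqrt_self_iff.1 hroot
  exact fun a => (f.le_opNorm a).trans (mul_le_of_le_one_left (norm_nonneg a) hf)

theorem isContraction_mapMatrix {φ : A →CP B} (hφ : φ.IsContraction) (n : Type*) [Fintype n] :
    (mapMatrix n φ).IsContraction :=
  isContraction_of_schwarz (schwarz_mapMatrix hφ)

/-- Choi's multiplicative domain: if the Schwarz inequality for `φ` at `a` becomes an equality under
`ψ`, then the positive matrix of Schwarz defects of `(a, b)` has a vanishing diagonal entry under
`ψ`, hence a vanishing row. -/
theorem map_map_star_mul_of_map_map_star_mul_self {φ : A →CP B} (hφ : φ.IsContraction)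
    (ψ : B →CP C) {a : A} (h : ψ (φ (star a * a)) = ψ (star (φ a) * φ a)) (b : A) :
    ψ (φ (star a * b)) = ψ (star (φ a) * φ b) := by
  have hrow : mapMatrix (Fin 2) φ (rowMatrix a b) = rowMatrix (φ a) (φ b) := by
    ext i j
    fin_cases i <;> fin_cases j <;> simp [rowMatrix, mapMatrix_apply]
  have hschwarz := schwarz_mapMatrix hφ (rowMatrix a b)
  rw [hrow, star_rowMatrix_mul_rowMatrix, star_rowMatrix_mul_rowMatrix] at hschwarz
  have hdefect := ψ.map_cstarMatrix_nonneg _ (sub_nonneg.2 hschwarz)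
  have hCS : star (ψ (φ (star a * b)) - ψ (star (φ a) * φ b)) *
      (ψ (φ (star a * b)) - ψ (star (φ a) * φ b)) ≤ 0 := by
    simpa [mapMatrix_apply, h] using star_apply_mul_apply_le_norm_smul hdefect 0 1
  exact sub_eq_zero.1 <|
    (CStarRing.star_mul_self_eq_zero_iff _).1 (hCS.antisymm (star_mul_self_nonneg _))

end Schwarz

section CompleteIsometries

variable {A B C : Type*} [NonUnitalCStarAlgebra A] [PartialOrder A] [StarOrderedRing A]
  [NonUnitalCStarAlgebra B] [PartialOrder B] [StarOrderedRing B]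
  [NonUnitalCStarAlgebra C] [PartialOrder C] [StarOrderedRing C]

/-- The completely positive map `φ` preserves the norms of square matrices with entries in the
subspace `S`. Unlike `IsCompletelyIsometric`, this leaves the codomain of `φ` unrestricted. -/
def CompletelyIsometricOn (φ : A →CP B) (S : Submodule ℂ A) : Prop :=
  ∀ ⦃n : ℕ⦄ (M : CStarMatrix (Fin n) (Fin n) A), (∀ i j, M i j ∈ S) → ‖M.map φ‖ = ‖M‖

theorem isCompletelyIsometric_iff {φ : A →CP B} {S : Submodule ℂ A} {T : Submodule ℂ B}
    {f : S →ₗ[ℂ] T} (hf : ∀ x, (f x : B) = φ x) :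
    IsCompletelyIsometric f ↔ CompletelyIsometricOn φ S := by
  have hmap (n : ℕ) (x : Fin n → Fin n → S) :
      (CStarMatrix.ofMatrix fun i j => (f (x i j) : B)) =
        (CStarMatrix.ofMatrix fun i j => (x i j : A)).map φ := by
    ext i j
    exact hf _
  simp only [IsCompletelyIsometric, hmap]
  exact ⟨fun h n M hM => h n fun i j => ⟨M i j, hM i j⟩,
    fun h n x => h _ fun i j => (x i j).2⟩

theorem CompletelyIsometricOn.norm_map {φ : A →CP B} {S : Submodule ℂ A}
    (hφ : CompletelyIsometricOn φ S) {a : A} (ha : a ∈ S) : ‖φ a‖ = ‖a‖ := by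
  have hentries (i j : Fin 1) : scalarHom (Fin 1) a i j ∈ S := by
    rwa [scalarHom_apply, if_pos (Subsingleton.elim i j)]
  have h := hφ _ hentries
  rwa [← mapMatrix_apply, mapMatrix_scalarHom, norm_scalarHom, norm_scalarHom] at h

theorem CompletelyIsometricOn.injOn {φ : A →CP B} {S : Submodule ℂ A}
    (hφ : CompletelyIsometricOn φ S) : Set.InjOn φ S := fun a ha b hb hab => by
  rw [← sub_eq_zero, ← norm_eq_zero, ← hφ.norm_map (S.sub_mem ha hb), map_sub, hab, sub_self,
    norm_zero]

theorem completelyIsometricOn_of_leftInvOn {φ : A →CP B} {ψ : B →CP A} {S : Submodule ℂ A}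
    (hφ : φ.IsContraction) (hψ : ψ.IsContraction) (h : Set.LeftInvOn ψ φ S) :
    CompletelyIsometricOn φ S := by
  intro n M hM
  have hM' : mapMatrix (Fin n) ψ (M.map φ) = M := by
    ext i j
    exact h (hM i j)
  refine le_antisymm (isContraction_mapMatrix hφ (Fin n) M) ?_
  simpa only [hM'] using isContraction_mapMatrix hψ (Fin n) (M.map φ)

/-- A square matrix with entries in the subspace `S` is positive as soon as its entrywise image
under the completely positive map `φ` is. -/
def ReflectsPositivityOn (φ : A →CP B) (S : Submodule ℂ A) : Prop :=
  ∀ ⦃n : ℕ⦄ (M : CStarMatrix (Fin n) (Fin n) A), (∀ i j, M i j ∈ S) → 0 ≤ M.map φ → 0 ≤ M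

theorem CompletelyIsometricOn.reflectsPositivityOn_top {φ : A →CP B}
    (hφ : CompletelyIsometricOn φ ⊤) : ReflectsPositivityOn φ ⊤ := fun n _ _ hM =>
  nonneg_of_map_nonneg_of_norm_map (PositiveLinearMap.ofClass (mapMatrix (Fin n) φ))
    (fun N => hφ N fun _ _ => Submodule.mem_top) hM

/-- A linear map into `S` is completely positive if composing it with a completely positive map
that reflects positivity on `S` makes it so. -/
def ReflectsPositivityOn.lift {φ : B →CP C} {S : Submodule ℂ B} (hφ : ReflectsPositivityOn φ S)
    (f : A →ₗ[ℂ] B) (hf : ∀ a, f a ∈ S) (g : A →CP C) (hg : ∀ a, φ (f a) = g a) : A →CP B where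
  toLinearMap := f
  map_cstarMatrix_nonneg' _ M hM := hφ (M.map f) (fun _ _ => hf _) <| by
    refine (g.map_cstarMatrix_nonneg M hM).trans_eq ?_
    ext i j
    exact (hg _).symm

theorem map_star_map_mul_map {φ : A →CP B} {ψ : B →CP A} (hφ : φ.IsContraction)
    (hψ : ψ.IsContraction) (h : Function.LeftInverse ψ φ) (a b : A) :
    ψ (star (φ a) * φ b) = star a * b := by
  have hupper : ψ (star (φ a) * φ a) ≤ ψ (φ (star a * a)) := OrderHomClass.mono ψ (schwarz hφ a)
  have hlower : ψ (φ (star a * a)) ≤ ψ (star (φ a) * φ a) := by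
    simpa only [h _] using schwarz hψ (φ a)
  rw [← map_map_star_mul_of_map_map_star_mul_self hφ ψ (hlower.antisymm hupper), h]

theorem exists_starAlgEquiv_of_inverse {φ : A →CP B} {ψ : B →CP A} (hφ : φ.IsContraction)
    (hψ : ψ.IsContraction) (hleft : Function.LeftInverse ψ φ) (hright : Function.RightInverse ψ φ) :
    ∃ β : A ≃⋆ₐ[ℂ] B, ∀ a, β a = φ a :=
  ⟨{ toFun := φ
     invFun := ψ
     left_inv := hleft
     right_inv := hright
     map_mul' := fun a b => by
      obtain ⟨c, rfl⟩ := star_involutive.surjective a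
      rw [← map_star_map_mul_map hφ hψ hleft, hright, map_star]
     map_add' := map_add φ
     map_star' := map_star φ
     map_smul' := map_smul φ }, fun _ => rfl⟩

theorem CompletelyIsometricOn.exists_starAlgEquiv {φ : A →CP B} (hφ : CompletelyIsometricOn φ ⊤)
    (hsurj : Function.Surjective φ) : ∃ β : A ≃⋆ₐ[ℂ] B, ∀ a, β a = φ a := by
  have hnorm (a : A) : ‖φ a‖ = ‖a‖ := hφ.norm_map Submodule.mem_top
  let e : A ≃ₗ[ℂ] B := LinearEquiv.ofBijective φ.toLinearMap ⟨Set.injOn_univ.1 hφ.injOn, hsurj⟩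
  have he (b : B) : φ (e.symm b) = b := e.apply_symm_apply b
  let ψ : B →CP A := hφ.reflectsPositivityOn_top.lift e.symm.toLinearMap
    (fun _ => Submodule.mem_top) (NonUnitalStarAlgHom.id ℂ B : B →⋆ₙₐ[ℂ] B) he
  exact exists_starAlgEquiv_of_inverse (ψ := ψ) (fun a => (hnorm a).le)
    (fun b => (hnorm _).symm.trans_le (congrArg norm (he b)).le) e.symm_apply_apply he

end CompleteIsometries

section Unital

variable {A B : Type*} [CStarAlgebra A] [PartialOrder A] [StarOrderedRing A]
  [CStarAlgebra B] [PartialOrder B] [StarOrderedRing B]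

theorem mapMatrix_one {φ : A →CP B} (hφ : φ 1 = 1) {n : Type*} [Fintype n] [DecidableEq n] :
    mapMatrix n φ 1 = 1 := by
  ext i j
  rw [mapMatrix_apply, CStarMatrix.map_apply, CStarMatrix.one_apply, CStarMatrix.one_apply,
    apply_ite φ, hφ, map_zero]

theorem CompletelyIsometricOn.reflectsPositivityOn_of_map_one {φ : A →CP B} {S : Submodule ℂ A}
    (hφ : CompletelyIsometricOn φ S) (hφ1 : φ 1 = 1) (h1 : 1 ∈ S) (hstar : ∀ a ∈ S, star a ∈ S) :
    ReflectsPositivityOn φ S := by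
  intro n M hM hφM
  have hφM_sa := IsSelfAdjoint.of_nonneg hφM
  have hsa : IsSelfAdjoint M := by
    ext i j
    refine hφ.injOn (hstar _ (hM j i)) (hM i j) ?_
    rw [map_star]
    exact CStarMatrix.ext_iff.2 hφM_sa i j
  have hentries (i j : Fin n) : ((‖M‖ : ℂ) • 1 - M) i j ∈ S := by
    rw [CStarMatrix.sub_apply, CStarMatrix.smul_apply, CStarMatrix.one_apply]
    refine S.sub_mem (S.smul_mem _ ?_) (hM i j)
    split_ifs
    exacts [h1, S.zero_mem]
  have hmap : mapMatrix (Fin n) φ ((‖M‖ : ℂ) • 1 - M) = (‖M‖ : ℂ) • 1 - mapMatrix (Fin n) φ M := by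
    rw [map_sub, map_smul, mapMatrix_one hφ1]
  rw [nonneg_iff_norm_smul_one_sub_le hφM_sa (hφ M hM).le, ← mapMatrix_apply, ← hmap,
    mapMatrix_apply, hφ _ hentries] at hφM
  exact (nonneg_iff_norm_smul_one_sub_le hsa le_rfl).2 hφM

end Unital

end CPMap

section Projections

universe u

variable {A : Type u} [NonUnitalCStarAlgebra A] [PartialOrder A] [StarOrderedRing A]

/-- An idempotent completely positive contraction of a C⋆-algebra into itself. -/
structure CPProjection (A : Type*) [NonUnitalCStarAlgebra A] [PartialOrder A] [StarOrderedRing A]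
    extends A →CP A where
  isContraction : toCompletelyPositiveMap.IsContraction
  idem (a : A) : toCompletelyPositiveMap (toCompletelyPositiveMap a) = toCompletelyPositiveMap a

namespace CPProjection

open CPMap

instance : CoeFun (CPProjection A) fun _ => A → A := ⟨fun E => E.toCompletelyPositiveMap⟩

variable (E : CPProjection A)

theorem mem_range_iff {a : A} : a ∈ E.range ↔ E a = a :=
  ⟨fun ⟨b, hb⟩ => hb ▸ E.idem b, fun h => ⟨a, h⟩⟩

theorem isClosed_range : IsClosed (E.range : Set A) := by
  rw [show (E.range : Set A) = {a | E a = a} from Set.ext fun _ => E.mem_range_iff]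
  exact isClosed_eq (map_continuous E.toCompletelyPositiveMap) continuous_id

/-- The entrywise action of a completely positive projection on square matrices. -/
def mapMatrix (n : Type*) [Fintype n] : CPProjection (CStarMatrix n n A) where
  toCompletelyPositiveMap := CPMap.mapMatrix n E.toCompletelyPositiveMap
  isContraction := isContraction_mapMatrix E.isContraction n
  idem M := by
    ext i j
    exact E.idem (M i j)

theorem apply_apply_mul (a b : A) : E (E a * b) = E (E a * E b) := by
  have hfix : E (star (E a)) = star (E a) := by rw [← map_star, E.idem]
  have h := map_map_star_mul_of_map_map_star_mul_self E.isContraction E.toCompletelyPositiveMap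
    (a := star (E a)) (by rw [E.idem, hfix]) b
  rwa [E.idem, hfix, star_star] at h

theorem apply_mul_apply (a b : A) : E (a * E b) = E (E a * E b) := by
  have h := congrArg star (E.apply_apply_mul (star b) (star a))
  simpa only [← map_star, star_mul, star_star] using h

end CPProjection

/-- The Choi–Effros algebra of a completely positive projection `E`: the range of `E` with the norm
and involution of `A` and the product `(x, y) ↦ E (x * y)`. -/
def ChoiEffros (E : CPProjection A) : Type u := E.range

namespace ChoiEffros

open CPMap

variable (E : CPProjection A)

noncomputable instance : NormedAddCommGroup (ChoiEffros E) :=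
  inferInstanceAs (NormedAddCommGroup E.range)

noncomputable instance : NormedSpace ℂ (ChoiEffros E) :=
  inferInstanceAs (NormedSpace ℂ E.range)

instance : CompleteSpace (ChoiEffros E) := E.isClosed_range.completeSpace_coe

/-- The inclusion of the Choi–Effros algebra, as a linear map. -/
def val : ChoiEffros E →ₗ[ℂ] A := E.range.subtype

/-- The projection onto the Choi–Effros algebra, as a linear map. -/
def proj : A →ₗ[ℂ] ChoiEffros E := E.toLinearMap.rangeRestrict

variable {E}

theorem val_injective : Function.Injective (val E) := Subtype.val_injective

theorem norm_val (x : ChoiEffros E) : ‖val E x‖ = ‖x‖ := rfl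

@[simp] theorem apply_val (x : ChoiEffros E) : E (val E x) = val E x :=
  E.mem_range_iff.1 x.2

theorem proj_val (x : ChoiEffros E) : proj E (val E x) = x :=
  val_injective (apply_val x)

noncomputable instance : Mul (ChoiEffros E) := ⟨fun x y => proj E (val E x * val E y)⟩

noncomputable instance : Star (ChoiEffros E) := ⟨fun x => proj E (star (val E x))⟩

@[simp] theorem val_mul (x y : ChoiEffros E) : val E (x * y) = E (val E x * val E y) := rfl

@[simp] theorem val_star (x : ChoiEffros E) : val E (star x) = star (val E x) :=
  (map_star E.toCompletelyPositiveMap (val E x)).trans (congrArg star (apply_val x))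

theorem apply_apply_mul_val (a : A) (x : ChoiEffros E) : E (E a * val E x) = E (a * val E x) := by
  simpa only [apply_val] using (E.apply_mul_apply a (val E x)).symm

theorem apply_val_mul_apply (x : ChoiEffros E) (a : A) : E (val E x * E a) = E (val E x * a) := by
  simpa only [apply_val] using (E.apply_apply_mul (val E x) a).symm

noncomputable instance : NonUnitalNormedRing (ChoiEffros E) where
  __ := (inferInstance : NormedAddCommGroup (ChoiEffros E))
  left_distrib x y z := val_injective (by simp [mul_add])
  right_distrib x y z := val_injective (by simp [add_mul])
  zero_mul x := val_injective (by simp)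
  mul_zero x := val_injective (by simp)
  mul_assoc x y z := val_injective (by simp [apply_apply_mul_val, apply_val_mul_apply, mul_assoc])
  norm_mul_le x y := (E.isContraction _).trans (norm_mul_le (val E x) (val E y))

noncomputable instance : StarRing (ChoiEffros E) where
  star_involutive x := val_injective (by simp)
  star_mul x y := val_injective (by simp [← map_star])
  star_add x y := val_injective (by simp)

instance : CStarRing (ChoiEffros E) where
  norm_mul_self_le x := by
    have h := schwarz E.isContraction (val E x)
    rw [apply_val] at h
    rw [← norm_val x, ← CStarRing.norm_star_mul_self, ← norm_val (star x * x), val_mul, val_star]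
    exact CStarAlgebra.norm_le_norm_of_nonneg_of_le (star_mul_self_nonneg _) h

noncomputable instance : NonUnitalCStarAlgebra (ChoiEffros E) where
  smul_assoc c x y := val_injective (by simp [smul_mul_assoc])
  smul_comm c x y := val_injective (by simp [mul_smul_comm])
  star_smul c x := val_injective (by simp)

noncomputable instance : PartialOrder (ChoiEffros E) := CStarAlgebra.spectralOrder _

instance : StarOrderedRing (ChoiEffros E) := CStarAlgebra.spectralOrderedRing _

/-- Matrices over the Choi–Effros algebra of `E` embed in the Choi–Effros algebra of the entrywise
action of `E` on matrices. Injective star homomorphisms being isometric, this identifies the norm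
of such matrices. -/
noncomputable def matrixHom (n : Type*) [Fintype n] :
    CStarMatrix n n (ChoiEffros E) →⋆ₙₐ[ℂ] ChoiEffros (E.mapMatrix n) where
  toFun M := ⟨M.map (val E), M.map (val E), by ext; exact apply_val _⟩
  map_smul' c M := val_injective (by ext i j; exact map_smul (val E) c (M i j))
  map_zero' := val_injective (by ext; exact map_zero (val E))
  map_add' M N := val_injective (by ext i j; exact map_add (val E) (M i j) (N i j))
  map_mul' M N := val_injective (by
    ext i j
    change val E (∑ k, M i k * N k j) = E (∑ k, val E (M i k) * val E (N k j))
    simp only [map_sum, val_mul])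
  map_star' M := val_injective (by
    refine Eq.trans ?_ (val_star _).symm
    ext i j
    exact val_star (M j i))

theorem norm_map_val {n : Type*} [Fintype n] (M : CStarMatrix n n (ChoiEffros E)) :
    ‖M.map (val E)‖ = ‖M‖ :=
  NonUnitalStarAlgHom.norm_map (matrixHom n) (fun _ _ hMN =>
    CStarMatrix.map_injective val_injective (congrArg (val _) hMN)) M

variable (E) in
/-- The inclusion of the Choi–Effros algebra, as a completely positive map. -/
noncomputable def inclusion : ChoiEffros E →CP A where
  toLinearMap := val E
  map_cstarMatrix_nonneg' k M hM := by
    obtain ⟨N, rfl⟩ := exists_star_mul_self_eq hM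
    refine (E.map_cstarMatrix_nonneg _ (star_mul_self_nonneg (N.map (val E)))).trans_eq ?_
    ext i j
    simp [CStarMatrix.mul_apply, CStarMatrix.star_apply]

theorem completelyIsometricOn_inclusion : CompletelyIsometricOn (inclusion E) ⊤ :=
  fun _ M _ => norm_map_val M

theorem isContraction_inclusion : (inclusion E).IsContraction := fun x => (norm_val x).le

variable (E) in
/-- The projection onto the Choi–Effros algebra, as a completely positive map. -/
noncomputable def projection : A →CP ChoiEffros E :=
  completelyIsometricOn_inclusion.reflectsPositivityOn_top.lift (proj E)
    (fun _ => Submodule.mem_top) E.toCompletelyPositiveMap fun _ => rfl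

theorem isContraction_projection : (projection E).IsContraction := E.isContraction

theorem exists_starAlgEquiv {P : A →CP A} (hmaps : Set.MapsTo P E.range E.range)
    (hiso : CompletelyIsometricOn P E.range) (hsurj : Set.SurjOn P E.range E.range) :
    ∃ β : ChoiEffros E ≃⋆ₐ[ℂ] ChoiEffros E, ∀ x, val E (β x) = P (val E x) := by
  let φ : ChoiEffros E →CP ChoiEffros E := comp (projection E) (comp P (inclusion E))
  have hφ (x : ChoiEffros E) : val E (φ x) = P (val E x) := E.mem_range_iff.1 (hmaps x.2)
  have hφ_iso : CompletelyIsometricOn φ ⊤ := by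
    intro n M _
    have hmap : (M.map φ).map (val E) = (M.map (val E)).map P := by
      ext i j
      exact hφ _
    rw [← norm_map_val, hmap, hiso (M.map (val E)) fun i j => (M i j).2, norm_map_val]
  have hφ_surj : Function.Surjective φ := fun y => by
    obtain ⟨x, hx, hxy⟩ := hsurj y.2
    exact ⟨⟨x, hx⟩, val_injective ((hφ _).trans hxy)⟩
  obtain ⟨β, hβ⟩ := hφ_iso.exists_starAlgEquiv hφ_surj
  exact ⟨β, fun x => by rw [hβ, hφ]⟩

end ChoiEffros

end Projections

section PolarFactorization

open CPMap

theorem isCompletelyIsometric_and_surjective_restrictRange_iff {A : Type*}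
    [NonUnitalCStarAlgebra A] [PartialOrder A] [StarOrderedRing A] {P : A →CP A} :
    IsCompletelyIsometric P.restrictRange ∧ Function.Surjective P.restrictRange ↔
      CompletelyIsometricOn P P.range ∧ Set.SurjOn P P.range P.range :=
  have hmaps : Set.MapsTo P P.range P.range := fun a _ => ⟨a, rfl⟩
  and_congr (isCompletelyIsometric_iff fun _ => rfl) hmaps.restrict_surjective_iff

universe u

variable {A : Type u} [NonUnitalCStarAlgebra A] [PartialOrder A] [StarOrderedRing A] {P Q : A →CP A}

theorem hasPolarFactorization_iff_exists_cpProjection :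
    HasPolarFactorization P ↔
      (CompletelyIsometricOn P P.range ∧ Set.SurjOn P P.range P.range) ∧
        ∃ E : CPProjection A, E.range = P.range ∧ ∀ a, P (E a) = P a := by
  constructor
  · rintro ⟨E, α, hE, hidem, hα, hsurj, hP⟩
    let E' : CPProjection A := ⟨E, hE, hidem⟩
    have hαP (x : E.range) : (α x : A) = P x := by
      rw [hP]
      congr 2
      exact Subtype.ext (E'.mem_range_iff.1 x.2).symm
    have hrange : E.range = P.range := by
      ext x
      constructor
      · intro hx
        obtain ⟨y, hy⟩ := hsurj ⟨x, hx⟩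
        exact ⟨y, (hαP y).symm.trans (congrArg Subtype.val hy)⟩
      · rintro ⟨a, rfl⟩
        exact (hP a).symm ▸ Subtype.property _
    refine ⟨hrange ▸ ⟨(isCompletelyIsometric_iff hαP).1 hα, fun y hy => ?_⟩, E', hrange,
      fun a => ?_⟩
    · obtain ⟨x, hx⟩ := hsurj ⟨y, hy⟩
      exact ⟨x, x.2, (hαP x).symm.trans (congrArg Subtype.val hx)⟩
    · rw [hP, hP]
      congr 2
      exact Subtype.ext (hidem a)
  · rintro ⟨⟨hiso, hsurj⟩, E, hrange, hPE⟩
    have hmaps (x : A) (_ : x ∈ E.range) : P x ∈ E.range := hrange ▸ ⟨x, rfl⟩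
    rw [← hrange] at hiso hsurj
    exact ⟨E.toCompletelyPositiveMap, P.toLinearMap.restrict hmaps, E.isContraction, E.idem,
      (isCompletelyIsometric_iff fun _ => rfl).2 hiso,
      (Set.MapsTo.restrict_surjective_iff hmaps).2 hsurj, fun a => (hPE a).symm⟩

theorem HasPolarFactorization.arisesFromDynamicalSystem (h : HasPolarFactorization P) :
    ArisesFromDynamicalSystem P := by
  obtain ⟨⟨hiso, hsurj⟩, E, hrange, hPE⟩ := hasPolarFactorization_iff_exists_cpProjection.1 h
  rw [← hrange] at hiso hsurj
  obtain ⟨β, hβ⟩ := ChoiEffros.exists_starAlgEquiv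
    (fun x _ => hrange.ge (LinearMap.mem_range_self P.toLinearMap x)) hiso hsurj
  refine ⟨ChoiEffros E, inferInstance, inferInstance, inferInstance, β, ChoiEffros.projection E,
    ChoiEffros.inclusion E, ChoiEffros.isContraction_projection,
    ChoiEffros.isContraction_inclusion, ChoiEffros.proj_val, fun a => ?_⟩
  exact ((hβ _).trans (hPE a)).symm

/-- `P` is completely isometric on its range because `Q` inverts it there. -/
theorem hasPolarFactorization_of_inverse_mod (hP : P.IsContraction) (hQ : Q.IsContraction)
    (E : CPProjection A) (hPQ : ∀ a, P (Q a) = E a) (hQP : ∀ a, Q (P a) = E a)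
    (hPE : ∀ a, P (E a) = P a) : HasPolarFactorization P := by
  have hEP (a : A) : E (P a) = P a := by rw [← hPQ, hQP, hPE]
  have hrange : E.range = P.range :=
    le_antisymm (fun x ⟨a, ha⟩ => ⟨Q a, (hPQ a).trans ha⟩) fun x ⟨a, ha⟩ => ⟨x, ha ▸ hEP a⟩
  refine hasPolarFactorization_iff_exists_cpProjection.2
    ⟨⟨completelyIsometricOn_of_leftInvOn hP hQ ?_, ?_⟩, E, hrange, hPE⟩
  · rintro _ ⟨a, rfl⟩
    exact (hQP _).trans (hEP a)
  · rintro _ ⟨a, rfl⟩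
    exact ⟨E a, hrange ▸ LinearMap.mem_range_self _ a, hPE a⟩

theorem ArisesFromDynamicalSystem.hasPolarFactorization (h : ArisesFromDynamicalSystem P) :
    HasPolarFactorization P := by
  obtain ⟨B, _, _, _, β, θ, θ', hθ, hθ', hid, hP⟩ := h
  have hcontr (γ : B ≃⋆ₐ[ℂ] B) : (comp θ' (comp (γ : B →CP B) θ)).IsContraction :=
    isContraction_comp hθ' (isContraction_comp (fun b => (StarAlgEquiv.norm_map γ b).le) hθ)
  have hPcontr : P.IsContraction := fun a => (hP a).symm ▸ hcontr β a
  let E : CPProjection A :=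
    ⟨comp θ' θ, isContraction_comp hθ' hθ, fun a => congrArg θ' (hid (θ a))⟩
  have hE (a : A) : E a = θ' (θ a) := rfl
  have hQ (a : A) : comp θ' (comp (β.symm : B →CP B) θ) a = θ' (β.symm (θ a)) := rfl
  refine hasPolarFactorization_of_inverse_mod hPcontr (hcontr β.symm) E (fun a => ?_) (fun a => ?_)
    fun a => ?_
  · rw [hP, hQ, hid, β.apply_symm_apply, hE]
  · rw [hP, hQ, hid, β.symm_apply_apply, hE]
  · rw [hP, hP, hE, hid]

theorem hasPolarFactorization_iff_arisesFromDynamicalSystem :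
    HasPolarFactorization P ↔ ArisesFromDynamicalSystem P :=
  ⟨HasPolarFactorization.arisesFromDynamicalSystem,
    ArisesFromDynamicalSystem.hasPolarFactorization⟩

end PolarFactorization

section UnitalMaps

open CPMap

variable {A : Type*} [CStarAlgebra A] [PartialOrder A] [StarOrderedRing A] {P : A →CP A}

theorem exists_cpProjection_of_map_one (hP : P.IsContraction) (hP1 : P 1 = 1)
    (hiso : CompletelyIsometricOn P P.range) (hsurj : Set.SurjOn P P.range P.range) :
    ∃ E : CPProjection A, E.range = P.range ∧ ∀ a, P (E a) = P a := by
  have hmaps : Set.MapsTo P P.range P.range := fun a _ => ⟨a, rfl⟩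
  let α : P.range ≃ₗ[ℂ] P.range := .ofBijective P.restrictRange
    ⟨hmaps.restrict_inj.2 hiso.injOn, hmaps.restrict_surjective_iff.2 hsurj⟩
  let F : A →ₗ[ℂ] A := P.range.subtype ∘ₗ α.symm.toLinearMap ∘ₗ P.toLinearMap.rangeRestrict
  have hmem (a : A) : F a ∈ P.range := Subtype.property _
  have hPF (a : A) : P (F a) = P a := congrArg Subtype.val (α.apply_symm_apply _)
  have hfix {a : A} (ha : a ∈ P.range) : F a = a := hiso.injOn (hmem a) ha (hPF a)
  have hstar : ∀ a ∈ P.range, star a ∈ P.range := by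
    rintro _ ⟨a, rfl⟩
    exact ⟨star a, map_star P a⟩
  let E : A →CP A :=
    (hiso.reflectsPositivityOn_of_map_one hP1 ⟨1, hP1⟩ hstar).lift F hmem P hPF
  have hE : E.IsContraction := fun a =>
    (hiso.norm_map (hmem a)).symm.trans_le (hPF a ▸ hP a)
  exact ⟨⟨E, hE, fun a => hfix (hmem a)⟩,
    le_antisymm (fun _ ⟨a, ha⟩ => ha ▸ hmem a) fun a ha => ⟨a, hfix ha⟩, hPF⟩

theorem hasPolarFactorization_iff_of_map_one (hP : P.IsContraction) (hP1 : P 1 = 1) :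
    HasPolarFactorization P ↔
      IsCompletelyIsometric P.restrictRange ∧ Function.Surjective P.restrictRange := by
  rw [isCompletelyIsometric_and_surjective_restrictRange_iff,
    hasPolarFactorization_iff_exists_cpProjection]
  exact and_iff_left_of_imp fun ⟨hiso, hsurj⟩ => exists_cpProjection_of_map_one hP hP1 hiso hsurj

end UnitalMaps

theorem proposition3p2 :
    (∀ (A : Type*) [NonUnitalCStarAlgebra A] [PartialOrder A] [StarOrderedRing A] (P : A →CP A),
      P.IsContraction →
        (HasPolarFactorization P ↔ ArisesFromDynamicalSystem P)) ∧
    (∀ (A : Type*) [CStarAlgebra A] [PartialOrder A] [StarOrderedRing A] (P : A →CP A),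
      P.IsContraction → P 1 = 1 →
        ((IsCompletelyIsometric P.restrictRange ∧ Function.Surjective P.restrictRange) ↔
          ArisesFromDynamicalSystem P)) := by
  refine ⟨fun A _ _ _ P _ => hasPolarFactorization_iff_arisesFromDynamicalSystem,
    fun A _ _ _ P hP hP1 => ?_⟩
  rw [← hasPolarFactorization_iff_of_map_one hP hP1]
  exact hasPolarFactorization_iff_arisesFromDynamicalSystem
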